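/- For a real number $x$ let $\deg(x)$ be the Turing degree of the binary expansion of its fractional part, let $\mathbb{R}_x=\{y\in\mathbb{R}:\deg(y)=\deg(x)\}$, and for $A\subseteq\mathbb{R}$ let $\mathbb{R}_A=\bigcup_{x\in A}\mathbb{R}_x$ be the closure of $A$ under Turing equivalence. Given an action of a group $G$ on the set $\mathbb{R}$, a $G$-selector is a set $S\subseteq\mathbb{R}$ such that for every $x\in\mathbb{R}$ there are $v\in S$ and $g\in G$ with $g\cdot x=v$, and such that for distinct $x,y\in S$ there is no $g\in G$ with $g\cdot x=y$. The action is paradoxical if every $G$-selector is not Lebesgue measurable; in that case the $G$-selectors are called $G$-Vitali sets. There are a countable group $G$ and a paradoxical action of $G$ on $\mathbb{R}$ such that for every $G$-Vitali set $A$ the set $\mathbb{R}_A$ is not Lebesgue measurable. Moreover, there is a set $L\subseteq\mathbb{R}$ of Lebesgue measure zero such that $\mathbb{R}_L$ is not Lebesgue measurable. -/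

import Mathlib

open MeasureTheory

/-- The oracle attached to a real number `x`: the (total) function sending `n` to the `n`-th binary
digit after the point of the fractional part of `x`. The integer part is finite information and
does not affect the Turing degree. -/
noncomputable def realOracle (x : ℝ) : ℕ →. ℕ :=
  fun n => Part.some ((Real.digits (Int.fract x) 2 n : Fin 2) : ℕ)

/-- The set of all reals that have the same Turing degree as `x`. -/
def realsOfDegree (x : ℝ) : Set ℝ :=
  {y | TuringEquivalent (realOracle y) (realOracle x)}

/-- The closure of a set `A` of reals under Turing equivalence: the union of the sets of reals
Turing equivalent to `x`, for `x ∈ A`. -/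
def turingClosure (A : Set ℝ) : Set ℝ :=
  ⋃ x ∈ A, realsOfDegree x

/-- `S` is a selector of the action of `G` on `ℝ`. -/
def IsSelector (G : Type) [Group G] [MulAction G ℝ] (S : Set ℝ) : Prop :=
  (∀ x : ℝ, ∃ v ∈ S, ∃ g : G, g • x = v) ∧
    ∀ x ∈ S, ∀ y ∈ S, x ≠ y → ¬ ∃ g : G, g • x = y

/-- A set of reals is Lebesgue measurable iff it is measurable for the completion of Borel-Lebesgue
measure, that is, equal to a Borel set up to a null set. -/
def LebesgueMeasurable (A : Set ℝ) : Prop :=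
  NullMeasurableSet A (volume : Measure ℝ)

/-- The action of `G` on `ℝ` is paradoxical: none of its selectors is Lebesgue measurable. -/
def IsParadoxicalAction (G : Type) [Group G] [MulAction G ℝ] : Prop :=
  ∀ S : Set ℝ, IsSelector G S → ¬ LebesgueMeasurable S

/-- A `G`-Vitali set is a selector of a paradoxical action of `G` on `ℝ`. -/
def IsVitaliSet (G : Type) [Group G] [MulAction G ℝ] (A : Set ℝ) : Prop :=
  IsParadoxicalAction G ∧ IsSelector G A

/-! Turing reductions are given by countably many programs, each inducing a Borel map on `ℝ`. By
Fubini some `z ≠ 0` has the property that, for almost every `x`, no `x + q * z` with `q ≠ 0`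
rational is Turing equivalent to `x`. Let E be generated by Turing equivalence and the translations
by `q * z`; its classes are countable. A transversal of E may be null, since a null set meets every
degree. So each class is split along a conull `X` whose null subsets have null preimages under the
countably many maps generating E. For a transversal `S` of the split relation, `S ∩ X` cannot be
null, as its preimages cover `X`, and cannot be measurable of positive measure, as it would contain
`x` and `x + q * z`. If the Turing closure of `S` were measurable, it would have positive measure
and contain a progression of three distinct degrees in one E-class, whereas `S` has at most two
points there. A single permutation has the split classes as orbits, so a cyclic group suffices. -/

/-! ### Oracle computation and its Borel measurability -/

/-- Programs for partial functions `ℕ →. ℕ` that may query an oracle. -/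
inductive OracleCode : Type
  | zero | succ | left | right | oracle
  | pair (c d : OracleCode)
  | comp (c d : OracleCode)
  | prec (c d : OracleCode)
  | rfind (c : OracleCode)
  deriving Countable

namespace OracleCode

/-- The partial function computed by a program with oracle `g`. -/
def eval (g : ℕ →. ℕ) : OracleCode → ℕ →. ℕ
  | zero => fun _ => 0
  | succ => Nat.succ
  | left => fun n => n.unpair.1
  | right => fun n => n.unpair.2
  | oracle => g
  | pair c d => fun n => Nat.pair <$> c.eval g n <*> d.eval g n
  | comp c d => fun n => d.eval g n >>= c.eval g
  | prec c d => fun p =>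
      let (a, n) := p.unpair
      n.rec (c.eval g a) fun y IH => do
        let i ← IH
        d.eval g (Nat.pair a (Nat.pair y i))
  | rfind c => fun a => Nat.rfind fun n => (fun m => m = 0) <$> c.eval g (Nat.pair a n)

theorem exists_eval_eq {f g : ℕ →. ℕ} (h : Nat.RecursiveIn {g} f) : ∃ c, eval g c = f := by
  induction h with
  | zero => exact ⟨zero, rfl⟩
  | succ => exact ⟨succ, rfl⟩
  | left => exact ⟨left, rfl⟩
  | right => exact ⟨right, rfl⟩
  | oracle k hk => exact ⟨oracle, hk.symm⟩
  | pair _ _ hc hd =>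
    obtain ⟨c, rfl⟩ := hc
    obtain ⟨d, rfl⟩ := hd
    exact ⟨pair c d, rfl⟩
  | comp _ _ hc hd =>
    obtain ⟨c, rfl⟩ := hc
    obtain ⟨d, rfl⟩ := hd
    exact ⟨comp c d, rfl⟩
  | prec _ _ hc hd =>
    obtain ⟨c, rfl⟩ := hc
    obtain ⟨d, rfl⟩ := hd
    exact ⟨prec c d, rfl⟩
  | rfind _ hc =>
    obtain ⟨c, rfl⟩ := hc
    exact ⟨rfind c, rfl⟩

/-- If the oracle depends measurably on a parameter, then so does the computed function. -/
theorem measurableSet_mem_eval {Ω : Type*} [MeasurableSpace Ω] {g : Ω → ℕ →. ℕ}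
    (hg : ∀ n m, MeasurableSet {ω | m ∈ g ω n}) (c : OracleCode) :
    ∀ n m, MeasurableSet {ω | m ∈ c.eval (g ω) n} := by
  induction c with
  -- The basic instructions ignore the oracle, so a dummy one exhibits the set as constant.
  | zero => exact fun n m => MeasurableSet.const (m ∈ zero.eval (fun _ => Part.none) n)
  | succ => exact fun n m => MeasurableSet.const (m ∈ succ.eval (fun _ => Part.none) n)
  | left => exact fun n m => MeasurableSet.const (m ∈ left.eval (fun _ => Part.none) n)
  | right => exact fun n m => MeasurableSet.const (m ∈ right.eval (fun _ => Part.none) n)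
  | oracle => exact hg
  | pair c d hc hd =>
    intro n m
    have : {ω | m ∈ (pair c d).eval (g ω) n} =
        ⋃ a : ℕ, ⋃ b : ℕ, ⋃ _ : Nat.pair a b = m,
          {ω | a ∈ c.eval (g ω) n} ∩ {ω | b ∈ d.eval (g ω) n} := by
      ext ω
      simp only [eval, seq_eq_bind_map, Part.bind_eq_bind, Part.map_eq_map, Part.bind_map,
        Part.mem_bind_iff, Part.mem_map_iff, Set.mem_ofPred_eq, Set.mem_iUnion, Set.mem_inter_iff]
      grind
    rw [this]
    exact .iUnion fun a => .iUnion fun b => .iUnion fun _ => (hc _ _).inter (hd _ _)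
  | comp c d hc hd =>
    intro n m
    have : {ω | m ∈ (comp c d).eval (g ω) n} =
        ⋃ a : ℕ, {ω | a ∈ d.eval (g ω) n} ∩ {ω | m ∈ c.eval (g ω) a} := by
      ext ω
      simp only [Set.mem_iUnion, Set.mem_inter_iff]
      exact Part.mem_bind_iff
    rw [this]
    exact .iUnion fun a => (hd _ _).inter (hc _ _)
  | prec c d hc hd =>
    intro p
    suffices H : ∀ a n m, MeasurableSet {ω | m ∈ (Nat.rec (c.eval (g ω) a)
        (fun y IH => IH.bind fun i => d.eval (g ω) (Nat.pair a (Nat.pair y i))) n : Part ℕ)} from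
      H p.unpair.1 p.unpair.2
    intro a n
    induction n with
    | zero => exact hc a
    | succ n ih =>
      intro m
      simp only [Part.mem_bind_iff]
      have h := fun i => (ih i).inter (hd (Nat.pair a (Nat.pair n i)) m)
      convert! MeasurableSet.iUnion h using 1
      ext ω
      simp
  | rfind c hc =>
    intro n m
    have : {ω | m ∈ (rfind c).eval (g ω) n} =
        {ω | 0 ∈ c.eval (g ω) (Nat.pair n m)} ∩
          ⋂ k : ℕ, ⋂ _ : k < m, ⋃ a : ℕ, {ω | a + 1 ∈ c.eval (g ω) (Nat.pair n k)} := by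
      ext ω
      simp only [Set.mem_inter_iff, Set.mem_iInter, Set.mem_iUnion]
      refine Nat.mem_rfind.trans (and_congr (by simp) (forall₂_congr fun k _ => ?_))
      simp only [Part.map_eq_map, Part.mem_map_iff]
      constructor
      · rintro ⟨a, ha, h⟩
        obtain ⟨b, rfl⟩ := Nat.exists_eq_succ_of_ne_zero (of_decide_eq_false h)
        exact ⟨b, ha⟩
      · rintro ⟨a, ha⟩
        exact ⟨a + 1, ha, by simp⟩
    rw [this]
    exact (hc _ _).inter (.iInter fun k => .iInter fun _ => .iUnion fun a => hc _ _)

end OracleCode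

theorem measurableSet_mem_realOracle (n m : ℕ) : MeasurableSet {x : ℝ | m ∈ realOracle x n} := by
  have h : Measurable fun x : ℝ => ((Real.digits (Int.fract x) 2 n : Fin 2) : ℕ) := by
    have h₁ : Measurable fun x : ℝ => ⌊Int.fract x * (2 : ℕ) ^ (n + 1)⌋₊ :=
      Nat.measurable_floor.comp (measurable_fract.mul_const _)
    exact (measurable_of_countable fun k : ℕ => ((Fin.ofNat 2 k : Fin 2) : ℕ)).comp h₁
  have h' : {x : ℝ | m ∈ realOracle x n} =
      (fun x : ℝ => ((Real.digits (Int.fract x) 2 n : Fin 2) : ℕ)) ⁻¹' {m} := by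
    ext x
    simp only [realOracle, Part.mem_some_iff, Set.mem_ofPred_eq, Set.mem_preimage,
      Set.mem_singleton_iff]
    exact eq_comm
  rw [h']
  exact h (measurableSet_singleton m)

open Classical in
/-- The map that computes the binary digits of a fractional part from its argument by the given
program, and adds a given integer. -/
noncomputable def turingMap (p : OracleCode × ℤ) (x : ℝ) : ℝ :=
  p.2 + Real.ofDigits (b := 2) fun n => if 1 ∈ p.1.eval (realOracle x) n then 1 else 0

theorem measurable_turingMap (p : OracleCode × ℤ) : Measurable (turingMap p) := by
  refine Measurable.const_add (Real.continuous_ofDigits.measurable.comp ?_) _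
  refine measurable_pi_lambda _ fun n => ?_
  exact Measurable.ite
    (OracleCode.measurableSet_mem_eval measurableSet_mem_realOracle p.1 n 1)
    measurable_const measurable_const

-- The integer part of `y` is not seen by the oracle; the integer in the index supplies it.
open Classical in
theorem exists_turingMap_eq {x y : ℝ} (h : TuringReducible (realOracle y) (realOracle x)) :
    ∃ p, turingMap p x = y := by
  obtain ⟨c, hc⟩ := OracleCode.exists_eval_eq (RecursiveIn.iff_nat.1 h)
  refine ⟨(c, ⌊y⌋), ?_⟩
  rw [turingMap, hc]
  have : (fun n => if 1 ∈ realOracle y n then (1 : Fin 2) else 0) =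
      Real.digits (Int.fract y) 2 := by
    funext n
    simp only [realOracle, Part.mem_some_iff]
    generalize Real.digits (Int.fract y) 2 n = d
    fin_cases d <;> simp
  simp only
  convert! Int.floor_add_fract y
  rw [← Real.ofDigits_digits (b := 2) one_lt_two ⟨Int.fract_nonneg y, Int.fract_lt_one y⟩, ← this]

/-! ### Tools from measure theory and countable equivalence relations -/

open Filter Topology Pointwise

/-- A measurable map is nonsingular over the complement of a null set: this removes the part of
the target that carries the singular part of the push-forward. -/
theorem exists_conull_preimage_null {f : ℝ → ℝ} (hf : Measurable f) :
    ∃ s : Set ℝ, volume sᶜ = 0 ∧ ∀ B ⊆ s, volume B = 0 → volume (f ⁻¹' B) = 0 := by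
  set ν := Measure.map f volume with hν
  obtain ⟨s, hs, hs₀, hs₁⟩ := Measure.mutuallySingular_singularPart ν (volume : Measure ℝ)
  refine ⟨s, hs₁, fun B hB hB₀ => ?_⟩
  obtain ⟨t, hBt, ht, ht₀⟩ := exists_measurable_superset_of_null hB₀
  have h : ν (t ∩ s) = 0 := by
    rw [Measure.haveLebesgueDecomposition_add ν (volume : Measure ℝ), Measure.add_apply,
      measure_mono_null Set.inter_subset_right hs₀, zero_add]
    exact withDensity_absolutelyContinuous _ _ (measure_mono_null Set.inter_subset_left ht₀)
  rw [hν, Measure.map_apply hf (ht.inter hs)] at h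
  exact measure_mono_null (Set.preimage_mono (Set.subset_inter hBt hB)) h

/-- A set of positive Lebesgue measure contains arithmetic progressions of length three whose
difference is a small element of any given sequence tending to zero. -/
theorem exists_threeTerm_of_pos_measure {B : Set ℝ} (hB : NullMeasurableSet B)
    (hpos : volume B ≠ 0) :
    ∀ᶠ h in 𝓝 (0 : ℝ), ∃ x ∈ B, x + h ∈ B ∧ x + 2 * h ∈ B := by
  obtain ⟨B', hB'B, hB', hBB'⟩ := hB.exists_measurable_subset_ae_eq
  have hpos' : 0 < volume B' := by
    rw [measure_congr hBB']
    exact pos_iff_ne_zero.2 hpos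
  obtain ⟨K, hKB, hK, hKpos⟩ := hB'.exists_lt_isCompact hpos'
  have hε : volume K / 3 ≠ 0 := by
    simp [hKpos.ne']
  have key := eventually_nhds_zero_measure_vadd_sdiff_lt (G := ℝ) (μ := volume) hK
    hK.isClosed hε
  have key' : ∀ᶠ h : ℝ in 𝓝 0, volume ((-h +ᵥ K) \ K) < volume K / 3 :=
    (by simpa using continuous_neg.tendsto (0 : ℝ) : Tendsto (fun h : ℝ => -h) (𝓝 0) (𝓝 0)) key
  have inv : ∀ h : ℝ, volume (K \ (-h +ᵥ K)) = volume ((h +ᵥ K) \ K) := by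
    intro h
    rw [← measure_vadd volume h (K \ (-h +ᵥ K)), Set.vadd_set_sdiff, vadd_vadd]
    simp
  filter_upwards [key, key'] with h h₁ h₂
  rw [← inv] at h₁ h₂
  by_contra! hno
  -- Here `y` plays the middle term: one of `y - h`, `y + h` must leave `K`, and each event has
  -- measure below a third of that of `K`.
  have hcover : K ⊆ (K \ (-h +ᵥ K)) ∪ (K \ (- -h +ᵥ K)) := by
    intro y hy
    by_contra hy'
    simp only [Set.mem_union, Set.mem_sdiff, hy, true_and, not_or, not_not,
      Set.mem_vadd_set_iff_neg_vadd_mem, neg_neg, vadd_eq_add] at hy'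
    refine hno (-h + y) (hB'B (hKB hy'.2)) (hB'B (hKB ?_)) (hB'B (hKB ?_))
    · simpa using hy
    · convert hy'.1 using 1
      ring
  have hlt : volume K / 3 + volume K / 3 < volume K := by
    have hfin : volume K ≠ ⊤ := hK.measure_lt_top.ne
    rw [← ENNReal.toReal_lt_toReal (by finiteness) hfin, ENNReal.toReal_add (by finiteness)
      (by finiteness), ENNReal.toReal_div]
    have := ENNReal.toReal_pos hKpos.ne' hfin
    norm_num
    linarith
  exact absurd ((measure_mono hcover).trans (measure_union_le _ _))
    (not_le.2 ((ENNReal.add_lt_add h₁ h₂).trans hlt))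

/-- A countable family of measurable maps disagrees almost everywhere with all nonzero rational
multiples of almost every translation. -/
theorem exists_translation_ae_ne {ι : Type*} [Countable ι] {f : ι → ℝ → ℝ}
    (hf : ∀ i, Measurable (f i)) :
    ∃ z : ℝ, z ≠ 0 ∧ ∀ᵐ x : ℝ, ∀ (i : ι) (q : ℚ), q ≠ 0 → x + q * z ≠ f i x := by
  have H : ∀ᵐ z : ℝ, ∀ᵐ x : ℝ, ∀ (i : ι) (q : ℚ), q ≠ 0 → x + q * z ≠ f i x := by
    have hone : ∀ (i : ι) (q : ℚ), ∀ᵐ z : ℝ, ∀ᵐ x : ℝ, q ≠ 0 → x + q * z ≠ f i x := by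
      intro i q
      by_cases hq : q = 0
      · simp [hq]
      have hq' : (q : ℝ) ≠ 0 := by exact_mod_cast hq
      have hmeas : MeasurableSet {p : ℝ × ℝ | q ≠ 0 → p.2 + q * p.1 ≠ f i p.2} := by
        simp only [ne_eq, hq, not_false_eq_true, forall_const]
        exact (measurableSet_eq_fun (measurable_snd.add (measurable_fst.const_mul _))
          ((hf i).comp measurable_snd)).compl
      -- With the quantifiers swapped, each `x` excludes a single value of `z`.
      rw [Measure.ae_ae_comm hmeas]
      refine ae_of_all _ fun x => ?_
      filter_upwards [Measure.ae_ne volume ((f i x - x) / q)] with z hz _ h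
      exact hz (by rw [← h]; field_simp; ring)
    have := ae_all_iff.2 fun i => ae_all_iff.2 (hone i)
    filter_upwards [this] with z hz
    exact ae_all_iff.2 fun i => ae_all_iff.2 (hz i)
  obtain ⟨z, hz, hz₀⟩ := (H.and (Measure.ae_ne volume (0 : ℝ))).exists
  exact ⟨z, hz₀, hz⟩

/-- An equivalence relation with countable classes is the orbit relation of a permutation. -/
theorem exists_perm_orbit_iff {α : Type*} (r : Setoid α) (hr : ∀ x, {y | r x y}.Countable) :
    ∃ σ : Equiv.Perm α, ∀ x y, (∃ n : ℤ, (σ ^ n) x = y) ↔ r x y := by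
  have hclass : ∀ c : Quotient r, ∃ τ : Equiv.Perm {x // Quotient.mk r x = c},
      ∀ x y, ∃ n : ℤ, (τ ^ n) x = y := by
    intro c
    have hc : Countable {x // Quotient.mk r x = c} := by
      induction c using Quotient.inductionOn with
      | h a =>
        refine ((hr a).mono fun x hx => ?_).to_subtype
        exact r.symm (Quotient.exact hx)
    have hne : Nonempty {x // Quotient.mk r x = c} := ⟨⟨c.out, c.out_eq⟩⟩
    -- `Nat.card` is `0` on an infinite class and `ZMod 0` is `ℤ`, so adding `1` is transitive in
    -- both cases.
    obtain ⟨e⟩ : Nonempty ({x // Quotient.mk r x = c} ≃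
        ZMod (Nat.card {x // Quotient.mk r x = c})) := by
      rcases finite_or_infinite {x // Quotient.mk r x = c} with h | h
      · have : NeZero (Nat.card {x // Quotient.mk r x = c}) := ⟨Nat.card_pos.ne'⟩
        exact Finite.card_eq.1 (by simp)
      · rw [Nat.card_eq_zero_of_infinite]
        exact nonempty_equiv_of_countable (β := ℤ)
    generalize Nat.card {x // Quotient.mk r x = c} = k at e
    refine ⟨e.symm.permCongrHom (AddAction.toPermHom (ZMod k) (ZMod k) 1).toMul, fun x y => ?_⟩
    obtain ⟨n, hn⟩ := ZMod.intCast_surjective (e y - e x)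
    refine ⟨n, ?_⟩
    rw [← map_zpow, ← toMul_zsmul, ← map_zsmul, zsmul_one, hn]
    change e.symm ((e y - e x) + e x) = y
    simp
  choose τ hτ using hclass
  set e := Equiv.sigmaFiberEquiv (Quotient.mk r)
  let F : (∀ c, Equiv.Perm {x // Quotient.mk r x = c}) →* Equiv.Perm α :=
    e.permCongrHom.toMonoidHom.comp (Equiv.Perm.sigmaCongrRightHom _)
  have hF : ∀ ρ x, F ρ x = ρ (Quotient.mk r x) ⟨x, rfl⟩ := fun ρ x => rfl
  refine ⟨F τ, fun x y => ?_⟩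
  simp only [← map_zpow, hF, Pi.pow_apply]
  constructor
  · rintro ⟨n, rfl⟩
    exact r.symm (Quotient.exact ((τ (Quotient.mk r x) ^ n) ⟨x, rfl⟩).2)
  · intro h
    obtain ⟨n, hn⟩ := hτ (Quotient.mk r x) ⟨x, rfl⟩ ⟨y, Quotient.sound (r.symm h)⟩
    exact ⟨n, congrArg Subtype.val hn⟩

/-! ### The relation generated by Turing equivalence and translations -/

theorem mem_turingClosure {A : Set ℝ} {x : ℝ} :
    x ∈ turingClosure A ↔ ∃ a ∈ A, TuringEquivalent (realOracle x) (realOracle a) := by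
  simp [turingClosure, realsOfDegree]

/-- The equivalence relation generated by Turing equivalence and the translations by the rational
multiples of `z`. -/
def turingTranslationSetoid (z : ℝ) : Setoid ℝ where
  r := Relation.ReflTransGen fun x y =>
    TuringEquivalent (realOracle x) (realOracle y) ∨ ∃ q : ℚ, x + q * z = y
  iseqv := by
    have : Std.Symm fun x y : ℝ =>
        TuringEquivalent (realOracle x) (realOracle y) ∨ ∃ q : ℚ, x + q * z = y := by
      refine ⟨?_⟩
      rintro x y (h | ⟨q, rfl⟩)
      · exact .inl h.symm
      · exact .inr ⟨-q, by push_cast; ring⟩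
    exact ⟨fun _ => .refl, fun h => Relation.ReflTransGen.stdSymm.symm _ _ h, .trans⟩

theorem turingTranslationSetoid_of_turingEquivalent {z x y : ℝ}
    (h : TuringEquivalent (realOracle x) (realOracle y)) : turingTranslationSetoid z x y :=
  .single (.inl h)

theorem turingTranslationSetoid_add (z x : ℝ) (q : ℚ) :
    turingTranslationSetoid z x (x + q * z) :=
  .single (.inr ⟨q, rfl⟩)

/-- Composition of a list of maps, each of which is given by an oracle program or is the translation
by a rational multiple of `z`. -/
noncomputable def turingTranslationMap (z : ℝ) : List (OracleCode × ℤ ⊕ ℚ) → ℝ → ℝ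
  | [], x => x
  | .inl p :: l, x => turingTranslationMap z l (turingMap p x)
  | .inr q :: l, x => turingTranslationMap z l (x + q * z)

theorem measurable_turingTranslationMap (z : ℝ) (l : List (OracleCode × ℤ ⊕ ℚ)) :
    Measurable (turingTranslationMap z l) := by
  induction l with
  | nil => exact measurable_id
  | cons s l ih =>
    rcases s with p | q
    · exact ih.comp (measurable_turingMap p)
    · exact ih.comp (measurable_id.add_const _)

theorem exists_turingTranslationMap_eq {z x y : ℝ} (h : turingTranslationSetoid z x y) :
    ∃ l, turingTranslationMap z l x = y := by
  replace h : Relation.ReflTransGen (fun x y =>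
    TuringEquivalent (realOracle x) (realOracle y) ∨ ∃ q : ℚ, x + q * z = y) x y := h
  induction h using Relation.ReflTransGen.head_induction_on with
  | refl => exact ⟨[], rfl⟩
  | head hs _ ih =>
    obtain ⟨l, hl⟩ := ih
    rcases hs with hs | ⟨q, rfl⟩
    · obtain ⟨p, rfl⟩ := exists_turingMap_eq hs.2
      exact ⟨.inl p :: l, hl⟩
    · exact ⟨.inr q :: l, hl⟩

theorem countable_turingTranslationSetoid (z x : ℝ) :
    {y | turingTranslationSetoid z x y}.Countable := by
  refine (Set.countable_range fun l => turingTranslationMap z l x).mono ?_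
  exact fun y hy => exists_turingTranslationMap_eq hy

/-! ### Transversals of the split relation and their Turing closures -/

/-- Refinement of an equivalence relation obtained by splitting each class along a set. -/
def splitSetoid (r : Setoid ℝ) (X : Set ℝ) : Setoid ℝ where
  r x y := r x y ∧ (x ∈ X ↔ y ∈ X)
  iseqv := ⟨fun x => ⟨r.refl x, Iff.rfl⟩, fun h => ⟨r.symm h.1, h.2.symm⟩,
    fun h h' => ⟨r.trans h.1 h'.1, h.2.trans h'.2⟩⟩

/-- The set `S` contains exactly one element of each class of `r`. -/
def IsTransversal (r : Setoid ℝ) (S : Set ℝ) : Prop :=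
  (∀ x, ∃ v ∈ S, r x v) ∧ ∀ x ∈ S, ∀ y ∈ S, r x y → x = y

theorem exists_isTransversal (r : Setoid ℝ) : ∃ S, IsTransversal r S := by
  refine ⟨Set.range (Quotient.out (s := r)), fun x => ⟨_, ⟨Quotient.mk r x, rfl⟩, ?_⟩, ?_⟩
  · exact r.symm (Quotient.mk_out x)
  · rintro _ ⟨c, rfl⟩ _ ⟨d, rfl⟩ h
    rw [Quotient.out_equiv_out.1 h]

theorem exists_rat_mul_of_eventually (z : ℝ) {p : ℝ → Prop}
    (h : ∀ᶠ t in 𝓝 0, p t) : ∃ q : ℚ, q ≠ 0 ∧ p (q * z) := by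
  have ht : Tendsto (fun n : ℕ => ((1 / ((n : ℚ) + 1) : ℚ) : ℝ) * z) atTop (𝓝 0) := by
    simpa using (tendsto_one_div_add_atTop_nhds_zero_nat (𝕜 := ℝ)).mul_const z
  obtain ⟨n, hn⟩ := (ht.eventually h).exists
  exact ⟨1 / ((n : ℚ) + 1), by positivity, hn⟩

/-- A transversal is not measurable if the null subsets of `X` have null saturations. -/
theorem not_nullMeasurableSet_of_isTransversal {z : ℝ} (hz : z ≠ 0) {X : Set ℝ}
    (hX : volume Xᶜ = 0)
    (hnull : ∀ l, ∀ B ⊆ X, volume B = 0 → volume (turingTranslationMap z l ⁻¹' B) = 0)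
    {S : Set ℝ} (hS : IsTransversal (splitSetoid (turingTranslationSetoid z) X) S) :
    ¬ NullMeasurableSet S := by
  intro hmeas
  have hXmeas : NullMeasurableSet X := (NullMeasurableSet.of_null hX).of_compl
  have hB₀ : volume (S ∩ X) = 0 := by
    by_contra hpos
    obtain ⟨q, hq, x, hx, hx', -⟩ := exists_rat_mul_of_eventually z
      (exists_threeTerm_of_pos_measure (hmeas.inter hXmeas) hpos)
    have := hS.2 x hx.1 _ hx'.1 ⟨turingTranslationSetoid_add z x q, by simp [hx.2, hx'.2]⟩
    have : (q : ℝ) * z = 0 := by linarith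
    exact mul_ne_zero (Rat.cast_ne_zero.2 hq) hz this
  have hcover : X ⊆ ⋃ l, turingTranslationMap z l ⁻¹' (S ∩ X) := by
    intro x hx
    obtain ⟨v, hv, hxv, hvX⟩ := hS.1 x
    obtain ⟨l, rfl⟩ := exists_turingTranslationMap_eq hxv
    exact Set.mem_iUnion.2 ⟨l, hv, hvX.1 hx⟩
  have hX₀ : volume X = 0 := measure_mono_null hcover
    (measure_iUnion_null fun l => hnull l _ Set.inter_subset_right hB₀)
  have huniv : volume (X ∪ Xᶜ) = 0 := measure_union_null hX₀ hX
  simp at huniv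

/-- The Turing closure of a transversal is not measurable. A set of positive measure
contains `x`, `x + q * z`, `x + 2 * (q * z)` of three different Turing degrees, whereas the
transversal meets their common class at most once inside and at most once outside `X`. -/
theorem not_nullMeasurableSet_turingClosure_of_isTransversal {z : ℝ}
    (hne : ∀ᵐ x : ℝ, ∀ (p : OracleCode × ℤ) (q : ℚ), q ≠ 0 → x + q * z ≠ turingMap p x)
    {X : Set ℝ} {S : Set ℝ}
    (hS : IsTransversal (splitSetoid (turingTranslationSetoid z) X) S)
    (hSmeas : ¬ NullMeasurableSet S) :
    ¬ NullMeasurableSet (turingClosure S) := by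
  intro hmeas
  set N := {x : ℝ | ∀ (p : OracleCode × ℤ) (q : ℚ), q ≠ 0 → x + q * z ≠ turingMap p x}
  have hne' : ∀ x ∈ N, ∀ q : ℚ, q ≠ 0 →
      ¬ TuringEquivalent (realOracle x) (realOracle (x + q * z)) := by
    intro x hx q hq h
    obtain ⟨p, hp⟩ := exists_turingMap_eq h.2
    exact hx p q hq hp.symm
  have hNmeas : NullMeasurableSet N := (NullMeasurableSet.of_null (mem_ae_iff.1 hne)).of_compl
  have hpos : volume (turingClosure S ∩ N) ≠ 0 := by
    intro h₀
    refine hSmeas (NullMeasurableSet.of_null (measure_mono_null (t := (turingClosure S ∩ N) ∪ Nᶜ)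
      ?_ (measure_union_null h₀ (mem_ae_iff.1 hne))))
    intro x hx
    by_cases hxN : x ∈ N
    · exact .inl ⟨mem_turingClosure.2 ⟨x, hx, .refl _⟩, hxN⟩
    · exact .inr hxN
  obtain ⟨q, hq, x, ⟨hx₀, hN₀⟩, ⟨hx₁, hN₁⟩, ⟨hx₂, -⟩⟩ := exists_rat_mul_of_eventually z
    (exists_threeTerm_of_pos_measure (hmeas.inter hNmeas) hpos)
  have e₂ : x + 2 * (q * z) = x + ((2 * q : ℚ) : ℝ) * z := by push_cast; ring
  have e₂' : x + 2 * (q * z) = x + q * z + q * z := by ring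
  obtain ⟨a, ha, hxa⟩ := mem_turingClosure.1 hx₀
  obtain ⟨b, hb, hxb⟩ := mem_turingClosure.1 hx₁
  obtain ⟨c, hc, hxc⟩ := mem_turingClosure.1 hx₂
  have hra : turingTranslationSetoid z x a := turingTranslationSetoid_of_turingEquivalent hxa
  have hrb : turingTranslationSetoid z x b := (turingTranslationSetoid z).trans
    (turingTranslationSetoid_add z x q) (turingTranslationSetoid_of_turingEquivalent hxb)
  have hrc : turingTranslationSetoid z x c := by
    refine (turingTranslationSetoid z).trans ?_ (turingTranslationSetoid_of_turingEquivalent hxc)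
    rw [e₂]
    exact turingTranslationSetoid_add z x _
  have hab : a ≠ b := by
    rintro rfl
    exact hne' x hN₀ q hq (AntisymmRel.trans hxa hxb.symm)
  have hac : a ≠ c := by
    rintro rfl
    refine hne' x hN₀ (2 * q) (by simpa using hq) ?_
    rw [← e₂]
    exact AntisymmRel.trans hxa hxc.symm
  have hbc : b ≠ c := by
    rintro rfl
    refine hne' _ hN₁ q hq ?_
    rw [← e₂']
    exact AntisymmRel.trans hxb hxc.symm
  have key : ∀ u ∈ S, ∀ v ∈ S, turingTranslationSetoid z x u → turingTranslationSetoid z x v →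
      u ≠ v → ¬ (u ∈ X ↔ v ∈ X) := by
    intro u hu v hv hxu hxv huv h
    exact huv (hS.2 u hu v hv
      ⟨(turingTranslationSetoid z).trans ((turingTranslationSetoid z).symm hxu) hxv, h⟩)
  have k₁ := key a ha b hb hra hrb hab
  have k₂ := key a ha c hc hra hrc hac
  have k₃ := key b hb c hc hrb hrc hbc
  tauto

/-! ### A null set meeting every Turing degree -/

/-- The sequence of digits obtained from `d` by inserting a zero after each digit. -/
def spreadDigits (d : ℕ → Fin 2) (n : ℕ) : Fin 2 :=
  if n % 2 = 0 then d (n / 2) else 0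

theorem ofDigits_eq_head_add {b : ℕ} (a : ℕ → Fin b) :
    Real.ofDigits a = (a 0 : ℕ) / b + Real.ofDigits (fun i => a (i + 1)) / b := by
  rw [Real.ofDigits_eq_sum_add_ofDigits a 1]
  simp [Real.ofDigitsTerm]
  ring

theorem ofDigits_lt_one_of_eq_zero {a : ℕ → Fin 2} {n : ℕ} (h : a n = 0) :
    Real.ofDigits a < 1 := by
  induction n generalizing a with
  | zero =>
    rw [ofDigits_eq_head_add, h]
    have := Real.ofDigits_le_one fun i => a (i + 1)
    norm_num
    linarith
  | succ n ih =>
    rw [ofDigits_eq_head_add]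
    have := ih (a := fun i => a (i + 1)) h
    have h' : ((a 0 : ℕ) : ℝ) ≤ 1 := by exact_mod_cast Nat.lt_succ_iff.1 (a 0).2
    push_cast
    linarith

/-- A binary expansion with infinitely many zeros is the standard one. -/
theorem digits_ofDigits_of_frequently_zero {a : ℕ → Fin 2} (h : ∀ n, ∃ m, a (m + n) = 0) :
    Real.digits (Int.fract (Real.ofDigits a)) 2 = a := by
  have hlt : ∀ n, Real.ofDigits (fun i => a (i + n)) < 1 := fun n =>
    let ⟨_, hm⟩ := h n
    ofDigits_lt_one_of_eq_zero hm
  have hfract : Int.fract (Real.ofDigits a) = Real.ofDigits a :=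
    Int.fract_eq_self.2 ⟨Real.ofDigits_nonneg a, hlt 0⟩
  -- `k` is the integer written by the first `n` digits, so its parity is the last of them.
  have hint : ∀ n, ∃ k : ℕ, Real.ofDigits a * 2 ^ n = k + Real.ofDigits (fun i => a (i + n)) ∧
      ∀ m, n = m + 1 → k % 2 = a m := by
    intro n
    induction n with
    | zero => exact ⟨0, by simp⟩
    | succ n ih =>
      obtain ⟨k, hk, -⟩ := ih
      refine ⟨2 * k + a n, ?_, ?_⟩
      · rw [pow_succ, ← mul_assoc, hk, ofDigits_eq_head_add (fun i => a (i + n))]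
        simp only [zero_add, add_assoc, add_comm 1 n]
        push_cast
        ring
      · intro m hm
        obtain rfl : n = m := by omega
        have := (a n).2
        omega
  funext n
  obtain ⟨k, hk, hkn⟩ := hint (n + 1)
  have hfloor : ⌊Real.ofDigits a * 2 ^ (n + 1)⌋₊ = k := by
    rw [hk, Nat.floor_eq_iff (add_nonneg k.cast_nonneg (Real.ofDigits_nonneg _))]
    exact ⟨by linarith [Real.ofDigits_nonneg fun i => a (i + (n + 1))], by linarith [hlt (n + 1)]⟩
  ext
  rw [Real.digits, hfract, Nat.cast_ofNat, hfloor, Fin.val_ofNat]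
  exact hkn n rfl

theorem realOracle_ofDigits_spreadDigits (d : ℕ → Fin 2) :
    realOracle (Real.ofDigits (spreadDigits d)) =
      fun n => Part.some ((spreadDigits d n : Fin 2) : ℕ) := by
  unfold realOracle
  rw [digits_ofDigits_of_frequently_zero]
  intro n
  -- The position `n + 1 + n` is odd, hence holds an inserted zero.
  refine ⟨n + 1, if_neg ?_⟩
  omega

theorem turingEquivalent_spreadDigits (x : ℝ) :
    TuringEquivalent (realOracle (Real.ofDigits (spreadDigits (Real.digits (Int.fract x) 2))))
      (realOracle x) := by
  rw [realOracle_ofDigits_spreadDigits]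
  set d := Real.digits (Int.fract x) 2
  have hx : realOracle x = fun n => Part.some ((d n : Fin 2) : ℕ) := rfl
  rw [hx]
  constructor
  · refine RecursiveIn.iff_nat.2 ?_
    have hdiv : Nat.RecursiveIn {fun n => Part.some ((d n : Fin 2) : ℕ)}
        (fun n : ℕ => Part.some (n / 2)) :=
      Nat.Primrec.recursiveIn (Primrec.nat_iff.1 (Primrec.nat_div.comp .id (.const 2)))
    -- Applied to the pair of `n` and `d (n / 2)`: the parity of `n` decides whether the digit is
    -- kept.
    have hmul : Nat.RecursiveIn {fun n => Part.some ((d n : Fin 2) : ℕ)}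
        (fun n : ℕ => Part.some (if n.unpair.1 % 2 = 0 then n.unpair.2 else 0)) := by
      refine Nat.Primrec.recursiveIn (f := fun n => if n.unpair.1 % 2 = 0 then n.unpair.2 else 0)
        (Primrec.nat_iff.1 ?_)
      refine Primrec.ite ?_ (Primrec.snd.comp .unpair) (.const 0)
      exact Primrec.eq.comp (Primrec.nat_mod.comp (Primrec.fst.comp .unpair) (.const 2)) (.const 0)
    have hid : Nat.RecursiveIn {fun n => Part.some ((d n : Fin 2) : ℕ)}
        (fun n : ℕ => Part.some n) := Nat.Primrec.recursiveIn .id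
    refine (hmul.comp (hid.pair ((Nat.RecursiveIn.oracle _ (Set.mem_singleton _)).comp hdiv))).of_eq fun n => ?_
    simp only [spreadDigits, Part.map_eq_map, seq_eq_bind_map]
    simp
    split_ifs <;> rfl
  · refine RecursiveIn.iff_nat.2 ?_
    have hdbl : Nat.RecursiveIn {fun n => Part.some ((spreadDigits d n : Fin 2) : ℕ)}
        (fun n : ℕ => Part.some (2 * n)) :=
      Nat.Primrec.recursiveIn (Primrec.nat_iff.1 (Primrec.nat_mul.comp (.const 2) .id))
    refine ((Nat.RecursiveIn.oracle _ (Set.mem_singleton _)).comp hdbl).of_eq fun n => ?_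
    simp [spreadDigits]

/-- The set is covered by two copies of itself scaled by `1/4`, one for each value of the first
digit, so its finite measure is at most half of itself. -/
theorem volume_range_ofDigits_spreadDigits :
    volume (Set.range fun d => Real.ofDigits (spreadDigits d)) = 0 := by
  set Z := Set.range fun d => Real.ofDigits (spreadDigits d)
  have hfin : volume Z ≠ ⊤ := by
    refine ((measure_mono (t := Set.Icc (0 : ℝ) 1) ?_).trans_lt measure_Icc_lt_top).ne
    rintro _ ⟨d, rfl⟩
    exact ⟨Real.ofDigits_nonneg _, Real.ofDigits_le_one _⟩
  have hsub : Z ⊆ ((4 : ℝ)⁻¹ • Z) ∪ ((1 / 2 : ℝ) +ᵥ ((4 : ℝ)⁻¹ • Z)) := by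
    rintro _ ⟨d, rfl⟩
    have hrec : Real.ofDigits (spreadDigits d) =
        ((d 0 : ℕ) : ℝ) / 2 + 4⁻¹ * Real.ofDigits (spreadDigits fun i => d (i + 1)) := by
      have hshift : (fun i => spreadDigits d (i + 1 + 1)) = spreadDigits fun i => d (i + 1) := by
        funext i
        simp [spreadDigits, add_assoc]
      rw [ofDigits_eq_head_add, ofDigits_eq_head_add (fun i => spreadDigits d (i + 1)), hshift]
      simp [spreadDigits]
      ring
    have hmem : (4 : ℝ)⁻¹ * Real.ofDigits (spreadDigits fun i => d (i + 1)) ∈ (4 : ℝ)⁻¹ • Z :=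
      Set.smul_mem_smul_set ⟨_, rfl⟩
    simp only [hrec]
    generalize d 0 = k
    fin_cases k
    · left; simpa using hmem
    · right
      simpa using Set.vadd_mem_vadd_set (a := (1 / 2 : ℝ)) hmem
  have hle : volume Z ≤ 4⁻¹ * volume Z + 4⁻¹ * volume Z := by
    refine ((measure_mono hsub).trans (measure_union_le _ _)).trans_eq ?_
    rw [measure_vadd, Measure.addHaar_smul]
    have : ENNReal.ofReal |(4 : ℝ)⁻¹ ^ Module.finrank ℝ ℝ| = 4⁻¹ := by
      rw [Module.finrank_self, pow_one, abs_of_pos (by norm_num),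
        ENNReal.ofReal_inv_of_pos (by norm_num)]
      norm_num
    rw [this]
  rw [← ENNReal.toReal_le_toReal hfin (by finiteness), ENNReal.toReal_add (by finiteness)
    (by finiteness), ENNReal.toReal_mul] at hle
  norm_num at hle
  have hnn : 0 ≤ (volume Z).toReal := ENNReal.toReal_nonneg
  exact ((ENNReal.toReal_eq_zero_iff _).1 (by linarith)).resolve_right hfin

/-- Spreading digits preserves the degree, so the null set of spread expansions meets every degree
in the closure of `A`. -/
theorem exists_null_turingClosure_eq (A : Set ℝ) :
    ∃ L : Set ℝ, volume L = 0 ∧ turingClosure L = turingClosure A := by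
  refine ⟨(Set.range fun d => Real.ofDigits (spreadDigits d)) ∩ turingClosure A,
    measure_mono_null Set.inter_subset_left volume_range_ofDigits_spreadDigits, ?_⟩
  ext x
  simp only [mem_turingClosure, Set.mem_inter_iff]
  constructor
  · rintro ⟨l, ⟨-, a, ha, hla⟩, hxl⟩
    exact ⟨a, ha, AntisymmRel.trans hxl hla⟩
  · rintro ⟨a, ha, hxa⟩
    have h := turingEquivalent_spreadDigits a
    exact ⟨_, ⟨⟨_, rfl⟩, a, ha, h⟩, AntisymmRel.trans hxa h.symm⟩

/-! ### Choice of the conull set, and assembly -/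

theorem exists_conull_preimage_turingTranslationMap_null (z : ℝ) :
    ∃ X : Set ℝ, volume Xᶜ = 0 ∧
      ∀ l, ∀ B ⊆ X, volume B = 0 → volume (turingTranslationMap z l ⁻¹' B) = 0 := by
  choose s hs hs' using fun l => exists_conull_preimage_null (measurable_turingTranslationMap z l)
  refine ⟨⋂ l, s l, ?_, fun l B hB => hs' l B (hB.trans (Set.iInter_subset _ _))⟩
  rw [Set.compl_iInter]
  exact measure_iUnion_null hs

theorem isSelector_zpowers_iff {r : Setoid ℝ} {σ : Equiv.Perm ℝ}
    (hσ : ∀ x y, (∃ n : ℤ, (σ ^ n) x = y) ↔ r x y) {S : Set ℝ} :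
    IsSelector (Subgroup.zpowers σ) S ↔ IsTransversal r S := by
  have horbit : ∀ x y : ℝ, (∃ g : Subgroup.zpowers σ, g • x = y) ↔ r x y := by
    intro x y
    rw [← hσ]
    constructor
    · rintro ⟨⟨_, n, rfl⟩, h⟩
      exact ⟨n, h⟩
    · rintro ⟨n, h⟩
      exact ⟨⟨_, n, rfl⟩, h⟩
  simp only [IsSelector, IsTransversal, horbit]
  refine and_congr_right fun _ => forall₄_congr fun x _ y _ => ?_
  tauto

theorem mainTheorem10 :
    (∃ (G : Type) (_ : Group G) (_ : MulAction G ℝ), Countable G ∧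
      IsParadoxicalAction G ∧
      ∀ A : Set ℝ, IsVitaliSet G A → ¬ LebesgueMeasurable (turingClosure A)) ∧
    ∃ L : Set ℝ, volume L = 0 ∧ ¬ LebesgueMeasurable (turingClosure L) := by
  obtain ⟨z, hz, hne⟩ := exists_translation_ae_ne measurable_turingMap
  obtain ⟨X, hX, hnull⟩ := exists_conull_preimage_turingTranslationMap_null z
  set r := splitSetoid (turingTranslationSetoid z) X
  have hvitali : ∀ S, IsTransversal r S → ¬ NullMeasurableSet S := fun S hS =>
    not_nullMeasurableSet_of_isTransversal hz hX hnull hS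
  have hclosure : ∀ S, IsTransversal r S → ¬ NullMeasurableSet (turingClosure S) := fun S hS =>
    not_nullMeasurableSet_turingClosure_of_isTransversal hne hS (hvitali S hS)
  obtain ⟨σ, hσ⟩ := exists_perm_orbit_iff r fun x =>
    (countable_turingTranslationSetoid z x).mono fun _ h => h.1
  have hsel : ∀ S, IsSelector (Subgroup.zpowers σ) S → IsTransversal r S := fun S =>
    (isSelector_zpowers_iff hσ).1
  refine ⟨⟨Subgroup.zpowers σ, inferInstance, inferInstance, ?_, fun S hS => hvitali S (hsel S hS),
    fun A hA => hclosure A (hsel A hA.2)⟩, ?_⟩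
  · exact (Set.countable_range fun n : ℤ => σ ^ n).to_subtype
  · obtain ⟨S, hS⟩ := exists_isTransversal r
    obtain ⟨L, hL, hLS⟩ := exists_null_turingClosure_eq S
    exact ⟨L, hL, by rw [hLS]; exact hclosure S hS⟩
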